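/- Conventions. Let $f$ be a homeomorphism of a metric space $X$. For $c>0$ and $x\in X$ put $W^s_c(x)=\{y: d(f^n(y),f^n(x))\le c\ \text{for all } n\ge 0\}$ and $W^u_c(x)=\{y: d(f^{-n}(y),f^{-n}(x))\le c\ \text{for all } n\ge 0\}$, and let $C^s_c(x)$, $C^u_c(x)$ be the connected components of $W^s_c(x)$, $W^u_c(x)$ that contain $x$. The homeomorphism $f$ is cw-expansive if for some $c>0$ every set $W^u_c(x)\cap W^s_c(x)$ is totally disconnected. It is cw-hyperbolic if $X$ is a Peano continuum (a compact, connected, locally connected metric space), $f$ is cw-expansive, and for each $\varepsilon>0$ there is $\delta>0$ such that $C^s_\varepsilon(x)\cap C^u_\varepsilon(y)\ne\emptyset$ whenever $d(x,y)<\delta$. For an integer $M\ge 0$, $f$ is cw$M$-expansive if it is cw-expansive and for some $c>0$ every set $C^s_c(x)\cap C^u_c(x)$ has at most $M$ elements; it is cw$M$-hyperbolic if it is cw-hyperbolic and cw$M$-expansive. A linear cw-Anosov homeomorphism of the unit sphere $\mathbb S^2\subset\mathbb R^3$ (with the Euclidean distance) is a homeomorphism $g$ of $\mathbb S^2$ for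 which there are an integer $2\times 2$ matrix $A$ with determinant one and no complex eigenvalue of modulus one, and a homeomorphism of $\mathbb T^2/(x\sim -x)$ onto $\mathbb S^2$, where $\mathbb T^2=\mathbb R^2/\mathbb Z^2$, that conjugates the map induced by $A$ on $\mathbb T^2/(x\sim -x)$ to $g$. Statement. For each integer $N\ge 0$ there exists a cw$(2^N)$-hyperbolic homeomorphism that is not cw$(2^N-1)$-expansive. More precisely, linear cw-Anosov homeomorphisms of $\mathbb S^2$ exist, and for every linear cw-Anosov homeomorphism $g$ of $\mathbb S^2$ and every integer $N\ge 0$, the product $g\times\dots\times g$ of $N$ copies of $g$, on $(\mathbb S^2)^N$ with the maximum metric, is cw$(2^N)$-hyperbolic and not cw$(2^N-1)$-expansive. -/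

import Mathlib

namespace CwHyp

section Dynamics

variable {X : Type*} [MetricSpace X]

/-- The local stable set `W^s_c(x)`. -/
def localStable (f : X ≃ₜ X) (c : ℝ) (x : X) : Set X :=
  {y | ∀ n : ℕ, dist (f^[n] y) (f^[n] x) ≤ c}

/-- The local unstable set `W^u_c(x)`. -/
def localUnstable (f : X ≃ₜ X) (c : ℝ) (x : X) : Set X :=
  {y | ∀ n : ℕ, dist (f.symm^[n] y) (f.symm^[n] x) ≤ c}

/-- `C^s_c(x)`: the connected component of `W^s_c(x)` that contains `x`. -/
def stableContinuum (f : X ≃ₜ X) (c : ℝ) (x : X) : Set X :=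
  connectedComponentIn (localStable f c x) x

/-- `C^u_c(x)`: the connected component of `W^u_c(x)` that contains `x`. -/
def unstableContinuum (f : X ≃ₜ X) (c : ℝ) (x : X) : Set X :=
  connectedComponentIn (localUnstable f c x) x

/-- Continuum-wise expansiveness. -/
def IsCwExpansive (f : X ≃ₜ X) : Prop :=
  ∃ c : ℝ, 0 < c ∧ ∀ x : X, IsTotallyDisconnected (localUnstable f c x ∩ localStable f c x)

/-- The cw-local-product-structure. -/
def HasCwLocalProductStructure (f : X ≃ₜ X) : Prop :=
  ∀ ε : ℝ, 0 < ε → ∃ δ : ℝ, 0 < δ ∧ ∀ x y : X, dist x y < δ →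
    (stableContinuum f ε x ∩ unstableContinuum f ε y).Nonempty

/-- A Peano continuum: a compact, connected and locally connected metric space. -/
def IsPeanoContinuum (X : Type*) [MetricSpace X] : Prop :=
  CompactSpace X ∧ ConnectedSpace X ∧ LocallyConnectedSpace X

/-- Continuum-wise hyperbolicity (of a homeomorphism of a Peano continuum). -/
def IsCwHyperbolic (f : X ≃ₜ X) : Prop :=
  IsPeanoContinuum X ∧ IsCwExpansive f ∧ HasCwLocalProductStructure f

/-- cwN-expansiveness. -/
def IsCwNExpansive (N : ℕ) (f : X ≃ₜ X) : Prop :=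
  IsCwExpansive f ∧
    ∃ c : ℝ, 0 < c ∧ ∀ x : X, (stableContinuum f c x ∩ unstableContinuum f c x).encard ≤ N

/-- cwN-hyperbolicity. -/
def IsCwNHyperbolic (N : ℕ) (f : X ≃ₜ X) : Prop :=
  IsCwHyperbolic f ∧ IsCwNExpansive N f

/-- The product of `N` copies of `f`; the space `Fin N → X` carries the maximum metric. -/
def prodCopies (N : ℕ) (f : X ≃ₜ X) : (Fin N → X) ≃ₜ (Fin N → X) :=
  Homeomorph.piCongrRight fun _ => f

end Dynamics

section LinearCwAnosov

/-- The torus `𝕋² = ℝ² / ℤ²`. -/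
abbrev Torus : Type := Fin 2 → UnitAddCircle

/-- The toral map `x ↦ A x` of an integer matrix. -/
def torusMap (A : Matrix (Fin 2) (Fin 2) ℤ) (x : Torus) : Torus :=
  fun i => ∑ j, A i j • x j

theorem torusMap_mul (A B : Matrix (Fin 2) (Fin 2) ℤ) (x : Torus) :
    torusMap A (torusMap B x) = torusMap (A * B) x := by
  funext i
  simp only [torusMap, Matrix.mul_apply, Fin.sum_univ_two, smul_add, add_smul, mul_smul]
  abel

theorem torusMap_one (x : Torus) : torusMap 1 x = x := by
  funext i
  simp [torusMap, Matrix.one_apply, ite_smul]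

theorem torusMap_neg (A : Matrix (Fin 2) (Fin 2) ℤ) (x : Torus) :
    torusMap A (-x) = -torusMap A x := by
  funext i
  simp [torusMap]

theorem continuous_torusMap (A : Matrix (Fin 2) (Fin 2) ℤ) : Continuous (torusMap A) := by
  unfold torusMap
  fun_prop

/-- Identification of each point of the torus with its image under the antipodal map `x ↦ -x`. -/
def antipodalSetoid : Setoid Torus where
  r x y := x = y ∨ x = -y
  iseqv :=
    { refl := fun _ => Or.inl rfl
      symm := by
        rintro x y (h | h)
        · exact Or.inl h.symm
        · exact Or.inr (by rw [h, neg_neg])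
      trans := by
        rintro x y z (rfl | rfl) (rfl | rfl) <;> simp }

/-- The quotient of the torus by the antipodal map, with the quotient topology. -/
abbrev TorusQuotient : Type := Quotient antipodalSetoid

/-- The map that the toral map of `A` induces on the quotient. -/
def quotientMap (A : Matrix (Fin 2) (Fin 2) ℤ) : TorusQuotient → TorusQuotient :=
  Quotient.map (sa := antipodalSetoid) (sb := antipodalSetoid) (torusMap A) (by
    rintro x y (rfl | rfl)
    · exact Or.inl rfl
    · exact Or.inr (torusMap_neg A y))

theorem quotientMap_mul (A B : Matrix (Fin 2) (Fin 2) ℤ) (q : TorusQuotient) :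
    quotientMap A (quotientMap B q) = quotientMap (A * B) q := by
  induction q using Quotient.inductionOn with
  | h x => simp only [quotientMap, Quotient.map_mk, torusMap_mul]

theorem quotientMap_one (q : TorusQuotient) : quotientMap 1 q = q := by
  induction q using Quotient.inductionOn with
  | h x => simp only [quotientMap, Quotient.map_mk, torusMap_one]

theorem continuous_quotientMap (A : Matrix (Fin 2) (Fin 2) ℤ) : Continuous (quotientMap A) :=
  (continuous_torusMap A).quotient_map' _

/-- The homeomorphism of the quotient induced by an integer matrix of determinant one. -/
def quotientHomeo (A : Matrix (Fin 2) (Fin 2) ℤ) (hA : A.det = 1) :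
    TorusQuotient ≃ₜ TorusQuotient where
  toFun := quotientMap A
  invFun := quotientMap A.adjugate
  left_inv q := by
    rw [quotientMap_mul, Matrix.adjugate_mul, hA, one_smul, quotientMap_one]
  right_inv q := by
    rw [quotientMap_mul, Matrix.mul_adjugate, hA, one_smul, quotientMap_one]
  continuous_toFun := continuous_quotientMap _
  continuous_invFun := continuous_quotientMap _

/-- A matrix is hyperbolic if it has no (complex) eigenvalue of modulus one. -/
def IsHyperbolicMatrix (A : Matrix (Fin 2) (Fin 2) ℤ) : Prop :=
  ∀ μ ∈ spectrum ℂ (A.map (Int.cast : ℤ → ℂ)), ‖μ‖ ≠ 1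

/-- The unit sphere of Euclidean three-space. -/
abbrev Sphere2 : Type := Metric.sphere (0 : EuclideanSpace ℝ (Fin 3)) 1

/-- A linear cw-Anosov map of the sphere: seeing the sphere, through some homeomorphism `h`, as
the quotient of the torus by the antipodal map, it is the map induced by the linear Anosov
diffeomorphism of a hyperbolic integer matrix of determinant one. -/
def IsLinearCwAnosov (g : Sphere2 ≃ₜ Sphere2) : Prop :=
  ∃ (A : Matrix (Fin 2) (Fin 2) ℤ) (hA : A.det = 1) (h : TorusQuotient ≃ₜ Sphere2),
    IsHyperbolicMatrix A ∧ ∀ q : TorusQuotient, g (h q) = h (quotientHomeo A hA q)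

end LinearCwAnosov

end CwHyp

/-! The sphere is the torus folded by x ↦ -x, and `g` is covered by a hyperbolic toral automorphism.
The dynamical argument uses only a projection `p` with fibres {x, -x} that semiconjugates the two
maps (`IsTorusFold`).

Small stable continua of `g` are, up to the choice of scale, images of short segments in the
contracted eigendirection `e` (`exists_stableContinuum_subset`, `exists_mem_stableContinuum`);
unstable ones are stable ones of the inverse, with direction `e'`. Connectedness is essential: a
point of the local stable set may follow x at some times and -x at others, but on a continuum one
choice of lift follows x throughout.

A point common to both continua of p x is p (x + a e) = p (x + b e'). Either x + a e = x + b e',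
which gives p x only, or a e + b e' = -2x, which has at most one small solution. So there are at
most two points (`exists_encard_le_two`), and near the branch point p 0 two do occur at every scale
(`exists_ne_mem_inter`). This finite bound also gives cw-expansiveness, and the local product
structure comes from linear coordinates on the torus.

For the maximum metric, continua of a product map are products of continua, so cardinalities
multiply and 2 becomes 2^N. Existence of `g` needs an explicit homeomorphism of the folded torus
onto the sphere: map the torus to a star-shaped "pillow" and project radially. -/

namespace CwHyp

open Set Filter Topology

/-! ### Toral maps and their lifts to the plane. -/

section TorusMap

variable {B : Matrix (Fin 2) (Fin 2) ℤ}

/-- The covering projection from the plane onto the torus. -/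
def toTorus (v : Fin 2 → ℝ) : Torus := fun i => (v i : UnitAddCircle)

/-- The real matrix underlying an integer matrix. -/
abbrev realMatrix (B : Matrix (Fin 2) (Fin 2) ℤ) : Matrix (Fin 2) (Fin 2) ℝ :=
  B.map (Int.cast : ℤ → ℝ)

theorem toTorus_add (v w : Fin 2 → ℝ) : toTorus (v + w) = toTorus v + toTorus w := rfl

theorem toTorus_neg (v : Fin 2 → ℝ) : toTorus (-v) = -toTorus v := rfl

theorem toTorus_sub (v w : Fin 2 → ℝ) : toTorus (v - w) = toTorus v - toTorus w := rfl

theorem toTorus_zero : toTorus 0 = 0 := rfl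

theorem continuous_toTorus : Continuous toTorus :=
  continuous_pi fun i => (AddCircle.continuous_mk' 1).comp (continuous_apply i)

theorem norm_toTorus_le (v : Fin 2 → ℝ) : ‖toTorus v‖ ≤ ‖v‖ := by
  rw [pi_norm_le_iff_of_nonneg (norm_nonneg _)]
  intro i
  refine le_trans ?_ (norm_le_pi_norm v i)
  rw [toTorus, UnitAddCircle.norm_eq, Real.norm_eq_abs]
  simpa using round_le (v i) 0

theorem norm_toTorus_of_le_half {v : Fin 2 → ℝ} (hv : ‖v‖ ≤ 1 / 2) : ‖toTorus v‖ = ‖v‖ := by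
  refine le_antisymm (norm_toTorus_le v) ?_
  rw [pi_norm_le_iff_of_nonneg (norm_nonneg _)]
  intro i
  have h1 : |v i| ≤ 1 / 2 := (norm_le_pi_norm v i).trans hv
  have h2 : ‖((v i : ℝ) : AddCircle (1 : ℝ))‖ = |v i| :=
    (AddCircle.norm_coe_eq_abs_iff 1 one_ne_zero).2 (by simpa using h1)
  rw [Real.norm_eq_abs, ← h2]
  exact norm_le_pi_norm (toTorus v) i

theorem exists_toTorus_eq (w : Torus) : ∃ v : Fin 2 → ℝ, toTorus v = w ∧ ‖v‖ = ‖w‖ := by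
  have key : ∀ i, ∃ r : ℝ, (r : UnitAddCircle) = w i ∧ |r| = ‖w i‖ := by
    intro i
    obtain ⟨r, hr⟩ := QuotientAddGroup.mk_surjective (w i)
    -- Subtracting the nearest integer gives the representative that realises the quotient norm.
    refine ⟨r - round r, ?_, ?_⟩
    · rw [← hr, AddCircle.coe_sub]
      have : ((round r : ℝ) : UnitAddCircle) = 0 := by
        rw [AddCircle.coe_eq_zero_iff]
        exact ⟨round r, by simp⟩
      rw [this, sub_zero]
    · rw [← hr]
      exact (UnitAddCircle.norm_eq).symm
  choose r hr hn using key
  refine ⟨r, funext hr, ?_⟩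
  simp only [Pi.norm_def]
  congr 2
  funext i
  exact NNReal.eq (hn i)

theorem eq_of_toTorus_eq {v w : Fin 2 → ℝ} (h : toTorus v = toTorus w)
    (hvw : ‖v - w‖ ≤ 1 / 2) : v = w := by
  have h1 := norm_toTorus_of_le_half hvw
  rw [toTorus_sub, h, sub_self, norm_zero] at h1
  exact sub_eq_zero.1 (norm_eq_zero.1 h1.symm)

theorem torusMap_add (B : Matrix (Fin 2) (Fin 2) ℤ) (x y : Torus) :
    torusMap B (x + y) = torusMap B x + torusMap B y := by
  funext i
  simp only [torusMap, Pi.add_apply, smul_add, Finset.sum_add_distrib]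

theorem torusMap_toTorus (B : Matrix (Fin 2) (Fin 2) ℤ) (v : Fin 2 → ℝ) :
    torusMap B (toTorus v) = toTorus ((realMatrix B).mulVec v) := by
  funext i
  simp [torusMap, toTorus, Matrix.mulVec, dotProduct, Fin.sum_univ_two, ← zsmul_eq_mul]

theorem continuous_iterate_torusMap (B : Matrix (Fin 2) (Fin 2) ℤ) (n : ℕ) :
    Continuous ((torusMap B)^[n]) := (continuous_torusMap B).iterate n

theorem iterate_torusMap_add (B : Matrix (Fin 2) (Fin 2) ℤ) (n : ℕ) (x y : Torus) :
    (torusMap B)^[n] (x + y) = (torusMap B)^[n] x + (torusMap B)^[n] y := by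
  induction n with
  | zero => rfl
  | succ n ih => simp only [Function.iterate_succ_apply', ih, torusMap_add]

theorem iterate_torusMap_neg (B : Matrix (Fin 2) (Fin 2) ℤ) (n : ℕ) (x : Torus) :
    (torusMap B)^[n] (-x) = -(torusMap B)^[n] x := by
  induction n with
  | zero => rfl
  | succ n ih => simp only [Function.iterate_succ_apply', ih, torusMap_neg]

theorem iterate_torusMap_sub (B : Matrix (Fin 2) (Fin 2) ℤ) (n : ℕ) (x y : Torus) :
    (torusMap B)^[n] (x - y) = (torusMap B)^[n] x - (torusMap B)^[n] y := by
  rw [sub_eq_add_neg, iterate_torusMap_add, iterate_torusMap_neg, ← sub_eq_add_neg]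

theorem iterate_torusMap_toTorus_smul {e : Fin 2 → ℝ} {μ : ℝ}
    (he : (realMatrix B).mulVec e = μ • e) (n : ℕ) (a : ℝ) :
    (torusMap B)^[n] (toTorus (a • e)) = toTorus ((μ ^ n * a) • e) := by
  induction n with
  | zero => simp
  | succ n ih =>
    rw [Function.iterate_succ_apply', ih, torusMap_toTorus, Matrix.mulVec_smul, he, smul_smul]
    congr 2
    ring

end TorusMap

/-! ### Eigenframes and orbits that stay near zero. -/

/-- A basis of the plane consisting of a contracted eigenvector `e` and an expanded eigenvector
`e'` of an integer matrix; `K` bounds the coordinates of a vector in terms of its norm. -/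
structure EigenFrame (B : Matrix (Fin 2) (Fin 2) ℤ) (e e' : Fin 2 → ℝ) (K : ℝ) : Prop where
  pos : 0 < K
  span : ∀ v : Fin 2 → ℝ, ∃ a b : ℝ, a • e + b • e' = v
  left_le : ∀ a b : ℝ, |a| ≤ K * ‖a • e + b • e'‖
  right_le : ∀ a b : ℝ, |b| ≤ K * ‖a • e + b • e'‖
  contracted : ∃ μ : ℝ, |μ| < 1 ∧ (realMatrix B).mulVec e = μ • e
  expanded : ∃ μ : ℝ, 1 < |μ| ∧ (realMatrix B).mulVec e' = μ • e'

section Frame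

variable {A B : Matrix (Fin 2) (Fin 2) ℤ} {e e' : Fin 2 → ℝ} {K : ℝ}

theorem realMatrix_mul_eq_one (h : A * B = 1) : realMatrix A * realMatrix B = 1 := by
  have h1 : (A * B).map (Int.castRingHom ℝ) = realMatrix A * realMatrix B := Matrix.map_mul
  rw [← h1, h]
  exact Matrix.map_one _ (map_zero _) (map_one _)

theorem mulVec_eigenvector_of_mul_eq_one (h : A * B = 1) {v : Fin 2 → ℝ} {μ : ℝ} (hμ : μ ≠ 0)
    (hv : (realMatrix B).mulVec v = μ • v) : (realMatrix A).mulVec v = μ⁻¹ • v := by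
  have h2 : (realMatrix A).mulVec ((realMatrix B).mulVec v) = v := by
    rw [Matrix.mulVec_mulVec, realMatrix_mul_eq_one h, Matrix.one_mulVec]
  rw [hv, Matrix.mulVec_smul] at h2
  rw [← h2, smul_smul, inv_mul_cancel₀ hμ, one_smul, h2]

theorem EigenFrame.left_ne_zero (F : EigenFrame B e e' K) : e ≠ 0 := by
  rintro rfl
  have := F.left_le 1 0
  norm_num at this

/-- The frame of the inverse matrix. -/
theorem EigenFrame.symm (F : EigenFrame B e e' K) (h : A * B = 1) :
    EigenFrame A e' e K where
  pos := F.pos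
  span v := by
    obtain ⟨a, b, hab⟩ := F.span v
    exact ⟨b, a, by rw [add_comm, hab]⟩
  left_le a b := by rw [add_comm]; exact F.right_le b a
  right_le a b := by rw [add_comm]; exact F.left_le b a
  contracted := by
    obtain ⟨μ, h1, h2⟩ := F.expanded
    refine ⟨μ⁻¹, ?_, mulVec_eigenvector_of_mul_eq_one h ?_ h2⟩
    · rw [abs_inv]
      exact inv_lt_one_of_one_lt₀ h1
    · rintro rfl
      norm_num at h1
  expanded := by
    obtain ⟨μ, h1, h2⟩ := F.contracted
    have h0 : μ ≠ 0 := by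
      rintro rfl
      have h3 : (realMatrix A * realMatrix B).mulVec e = 0 := by
        rw [← Matrix.mulVec_mulVec, h2, zero_smul, Matrix.mulVec_zero]
      rw [realMatrix_mul_eq_one h, Matrix.one_mulVec] at h3
      exact F.left_ne_zero h3
    refine ⟨μ⁻¹, ?_, mulVec_eigenvector_of_mul_eq_one h h0 h2⟩
    rw [abs_inv]
    exact (one_lt_inv₀ (abs_pos.2 h0)).2 h1

/-- Points of the torus whose forward orbits stay close to zero lie on the stable line. -/
theorem EigenFrame.exists_of_iterate_le (F : EigenFrame B e e' K) :
    ∃ η₀ : ℝ, 0 < η₀ ∧ ∀ η ≤ η₀, ∀ w : Torus, (∀ n : ℕ, ‖(torusMap B)^[n] w‖ ≤ η) →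
      ∃ a : ℝ, |a| ≤ K * η ∧ w = toTorus (a • e) := by
  obtain ⟨C, hC0, hC⟩ : ∃ C : ℝ, 0 < C ∧ ∀ v, ‖(realMatrix B).mulVec v‖ ≤ C * ‖v‖ := by
    let T := LinearMap.toContinuousLinearMap (Matrix.mulVecLin (realMatrix B))
    obtain ⟨C, hC, h⟩ := T.bound
    exact ⟨C, hC, h⟩
  -- With `C` a bound for the linear map, a vector of norm at most η has image of norm at most 1/2,
  -- where the projection preserves norms. Hence the linear orbit of the short lift keeps projecting
  -- isometrically and stays bounded for all time.
  refine ⟨min (1 / 2) (1 / 2 / C), by positivity, fun η hη w hw => ?_⟩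
  have hη1 : η ≤ 1 / 2 := hη.trans (min_le_left _ _)
  have hη2 : C * η ≤ 1 / 2 := by
    have := hη.trans (min_le_right _ _)
    rwa [le_div_iff₀' hC0] at this
  obtain ⟨v, rfl, hv⟩ := exists_toTorus_eq w
  have key : ∀ n : ℕ, ‖((realMatrix B).mulVec)^[n] v‖ ≤ η ∧
      (torusMap B)^[n] (toTorus v) = toTorus (((realMatrix B).mulVec)^[n] v) := by
    intro n
    induction n with
    | zero => exact ⟨by simpa [hv] using hw 0, rfl⟩
    | succ n ih =>
      have h1 : (torusMap B)^[n + 1] (toTorus v)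
          = toTorus (((realMatrix B).mulVec)^[n + 1] v) := by
        rw [Function.iterate_succ_apply', ih.2, torusMap_toTorus, Function.iterate_succ_apply']
      refine ⟨?_, h1⟩
      have h2 : ‖((realMatrix B).mulVec)^[n + 1] v‖ ≤ 1 / 2 := by
        rw [Function.iterate_succ_apply']
        exact ((hC _).trans (mul_le_mul_of_nonneg_left ih.1 hC0.le)).trans hη2
      rw [← norm_toTorus_of_le_half h2, ← h1]
      exact hw _
  obtain ⟨a, b, rfl⟩ := F.span v
  obtain ⟨μ, -, he⟩ := F.contracted
  obtain ⟨ν, hν, he'⟩ := F.expanded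
  have hit : ∀ n : ℕ, ((realMatrix B).mulVec)^[n] (a • e + b • e')
      = (μ ^ n * a) • e + (ν ^ n * b) • e' := by
    intro n
    induction n with
    | zero => simp
    | succ n ih =>
      rw [Function.iterate_succ_apply', ih, Matrix.mulVec_add, Matrix.mulVec_smul,
        Matrix.mulVec_smul, he, he', smul_smul, smul_smul]
      congr 2 <;> ring
  -- A nonzero expanded coordinate would grow beyond the bound K η.
  have hb : b = 0 := by
    by_contra hb
    obtain ⟨n, hn⟩ := pow_unbounded_of_one_lt (K * η / |b|) hν
    have h1 := F.right_le (μ ^ n * a) (ν ^ n * b)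
    rw [← hit, abs_mul, abs_pow] at h1
    have h2 := h1.trans (mul_le_mul_of_nonneg_left (key n).1 F.pos.le)
    rw [div_lt_iff₀ (abs_pos.2 hb)] at hn
    linarith
  subst hb
  refine ⟨a, ?_, by simp⟩
  exact (F.left_le a 0).trans (mul_le_mul_of_nonneg_left (key 0).1 F.pos.le)

end Frame

/-! ### Eigenframes of hyperbolic matrices, and an example. -/

section Existence

/-- Two independent vectors of the plane have coordinates bounded by the norm. -/
theorem exists_frame_bound {e e' : Fin 2 → ℝ} (h : e 0 * e' 1 - e 1 * e' 0 ≠ 0) :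
    ∃ K : ℝ, 0 < K ∧ (∀ v : Fin 2 → ℝ, ∃ a b : ℝ, a • e + b • e' = v) ∧
      (∀ a b : ℝ, |a| ≤ K * ‖a • e + b • e'‖) ∧ ∀ a b : ℝ, |b| ≤ K * ‖a • e + b • e'‖ := by
  set D := e 0 * e' 1 - e 1 * e' 0 with hD
  have hD0 : 0 < |D| := abs_pos.2 h
  have hcoord : ∀ (u v : Fin 2 → ℝ), |v 0 * u 1 - v 1 * u 0| ≤ 2 * ‖u‖ * ‖v‖ := by
    intro u v
    have h0 := norm_le_pi_norm u 0
    have h1 := norm_le_pi_norm u 1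
    have h2 := norm_le_pi_norm v 0
    have h3 := norm_le_pi_norm v 1
    rw [Real.norm_eq_abs] at h0 h1 h2 h3
    calc |v 0 * u 1 - v 1 * u 0| ≤ |v 0| * |u 1| + |v 1| * |u 0| := by
          rw [← abs_mul, ← abs_mul]; exact abs_sub _ _
      _ ≤ ‖v‖ * ‖u‖ + ‖v‖ * ‖u‖ := by gcongr
      _ = _ := by ring
  refine ⟨2 * (‖e‖ + ‖e'‖ + 1) / |D|, by positivity, fun v => ?_, fun a b => ?_, fun a b => ?_⟩
  -- Cramer's rule; the two bounds below also come from wedging with e' and with e.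
  · refine ⟨(v 0 * e' 1 - v 1 * e' 0) / D, (e 0 * v 1 - e 1 * v 0) / D, ?_⟩
    funext i
    simp only [Pi.add_apply, Pi.smul_apply, smul_eq_mul]
    rw [div_mul_eq_mul_div, div_mul_eq_mul_div, ← add_div, div_eq_iff h, hD]
    fin_cases i <;> simp <;> ring
  · rw [div_mul_eq_mul_div, le_div_iff₀ hD0, ← abs_mul]
    have h1 := hcoord e' (a • e + b • e')
    have h2 : (a • e + b • e') 0 * e' 1 - (a • e + b • e') 1 * e' 0 = a * D := by
      simp [hD]; ring
    rw [h2] at h1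
    refine h1.trans ?_
    gcongr
    linarith [norm_nonneg e]
  · rw [div_mul_eq_mul_div, le_div_iff₀ hD0, ← abs_mul, ← abs_neg]
    have h1 := hcoord e (a • e + b • e')
    have h2 : (a • e + b • e') 0 * e 1 - (a • e + b • e') 1 * e 0 = -(b * D) := by
      simp [hD]; ring
    rw [h2] at h1
    refine h1.trans ?_
    gcongr
    linarith [norm_nonneg e']

/-- If t² ≤ 4, the root (t + i√(4 - t²))/2 of the characteristic polynomial X² - tX + 1 has modulus
one. -/
theorem two_lt_abs_trace {A : Matrix (Fin 2) (Fin 2) ℤ} (hA : A.det = 1)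
    (h : IsHyperbolicMatrix A) : (4 : ℝ) < ((A 0 0 + A 1 1 : ℤ) : ℝ) ^ 2 := by
  by_contra hle
  rw [not_lt] at hle
  set t : ℝ := ((A 0 0 + A 1 1 : ℤ) : ℝ) with ht
  have hs : Real.sqrt (4 - t ^ 2) ^ 2 = 4 - t ^ 2 := Real.sq_sqrt (by linarith)
  set s := Real.sqrt (4 - t ^ 2)
  have hdet : (A 0 0 : ℝ) * A 1 1 - A 0 1 * A 1 0 = 1 := by
    rw [Matrix.det_fin_two] at hA
    exact_mod_cast hA
  refine h ⟨t / 2, s / 2⟩ ?_ ?_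
  · rw [spectrum.mem_iff, Matrix.isUnit_iff_isUnit_det, isUnit_iff_ne_zero, not_not,
      Matrix.det_fin_two]
    simp only [Matrix.sub_apply, Matrix.map_apply, Matrix.algebraMap_matrix_apply]
    push_cast at ht
    apply Complex.ext
    · simp
      linear_combination hdet - hs / 4 + t / 2 * ht
    · simp
      linear_combination s / 2 * ht
  · have h1 : ‖(⟨t / 2, s / 2⟩ : ℂ)‖ ^ 2 = 1 := by
      rw [← Complex.normSq_eq_norm_sq, Complex.normSq_mk]
      nlinarith
    nlinarith [norm_nonneg (⟨t / 2, s / 2⟩ : ℂ)]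

theorem exists_eigenvector (A : Matrix (Fin 2) (Fin 2) ℤ) {μ : ℝ}
    (h : μ ^ 2 - (A 0 0 + A 1 1) * μ + ((A 0 0 : ℝ) * A 1 1 - A 0 1 * A 1 0) = 0) :
    ∃ v ≠ 0, (realMatrix A).mulVec v = μ • v := by
  obtain ⟨v, hv, h1⟩ := (Matrix.exists_mulVec_eq_zero_iff
    (M := realMatrix A - Matrix.scalar (Fin 2) μ)).2 (by
      rw [Matrix.det_fin_two]
      simp
      linarith)
  refine ⟨v, hv, ?_⟩
  rw [Matrix.sub_mulVec, sub_eq_zero] at h1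
  rw [h1]
  simp [Matrix.scalar_apply]

/-- If v and w were parallel, then v i * w j = v j * w i; applying `M` to either factor scales this
product by μ or by ν, so all these products vanish. -/
theorem wedge_ne_zero_of_eigenvectors {M : Matrix (Fin 2) (Fin 2) ℝ} {v w : Fin 2 → ℝ} {μ ν : ℝ}
    (hv : v ≠ 0) (hw : w ≠ 0) (hμν : μ ≠ ν) (h1 : M.mulVec v = μ • v)
    (h2 : M.mulVec w = ν • w) : v 0 * w 1 - v 1 * w 0 ≠ 0 := by
  intro h0
  have h10 := congrFun h1 0
  have h11 := congrFun h1 1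
  have h20 := congrFun h2 0
  have h21 := congrFun h2 1
  simp only [Matrix.mulVec, dotProduct, Fin.sum_univ_two, Pi.smul_apply, smul_eq_mul]
    at h10 h11 h20 h21
  have key : ∀ i j : Fin 2, v i * w j = v j * w i := by
    intro i j
    fin_cases i <;> fin_cases j <;> simp <;> linarith
  have hz : ∀ i j : Fin 2, v i * w j = 0 := by
    intro i j
    have hi : ∑ k, M i k * v k = μ * v i := congrFun h1 i
    have hi' : ∑ k, M i k * w k = ν * w i := congrFun h2 i
    rw [Fin.sum_univ_two] at hi hi'
    have h3 : (μ - ν) * (v i * w j) = 0 := by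
      have e1 : μ * (v i * w j) = (M i 0 * v 0 + M i 1 * v 1) * w j := by rw [hi]; ring
      have e2 : ν * (v j * w i) = (M i 0 * w 0 + M i 1 * w 1) * v j := by rw [hi']; ring
      rw [sub_mul, e1, key i j, e2]
      linear_combination M i 0 * key 0 j + M i 1 * key 1 j
    exact (mul_eq_zero.1 h3).resolve_left (sub_ne_zero.2 hμν)
  obtain ⟨i, hi⟩ := Function.ne_iff.1 hv
  obtain ⟨j, hj⟩ := Function.ne_iff.1 hw
  exact (mul_ne_zero hi hj) (hz i j)

theorem exists_eigenFrame {A : Matrix (Fin 2) (Fin 2) ℤ} (hA : A.det = 1)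
    (h : IsHyperbolicMatrix A) : ∃ e e' K, EigenFrame A e e' K := by
  have ht := two_lt_abs_trace hA h
  have hdet : (A 0 0 : ℝ) * A 1 1 - A 0 1 * A 1 0 = 1 := by
    rw [Matrix.det_fin_two] at hA
    exact_mod_cast hA
  push_cast at ht
  obtain ⟨μ, ν, hsum, hprod, hμ⟩ : ∃ μ ν : ℝ, μ + ν = A 0 0 + A 1 1 ∧ μ * ν = 1 ∧ |μ| < 1 := by
    set t : ℝ := (A 0 0 : ℝ) + A 1 1
    have hs : Real.sqrt (t ^ 2 - 4) ^ 2 = t ^ 2 - 4 := Real.sq_sqrt (by linarith)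
    have hs0 : 0 < Real.sqrt (t ^ 2 - 4) := Real.sqrt_pos.2 (by linarith)
    set s := Real.sqrt (t ^ 2 - 4)
    -- The roots have product one; the sign of the trace tells which is the smaller in modulus.
    rcases le_total 0 t with h0 | h0
    · refine ⟨(t - s) / 2, (t + s) / 2, by ring, by nlinarith, ?_⟩
      rw [abs_lt]
      constructor <;> nlinarith
    · refine ⟨(t + s) / 2, (t - s) / 2, by ring, by nlinarith, ?_⟩
      rw [abs_lt]
      constructor <;> nlinarith
  have hμ0 : μ ≠ 0 := by
    rintro rfl
    norm_num at hprod
  have hν : 1 < |ν| := by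
    have h1 : |μ| * |ν| = 1 := by rw [← abs_mul, hprod, abs_one]
    nlinarith [abs_pos.2 hμ0]
  obtain ⟨e, he, hev⟩ := exists_eigenvector A (μ := μ) (by rw [← hsum, hdet]; linear_combination -hprod)
  obtain ⟨e', he', hev'⟩ := exists_eigenvector A (μ := ν)
    (by rw [← hsum, hdet]; linear_combination -hprod)
  have hne : μ ≠ ν := by
    rintro rfl
    linarith
  obtain ⟨K, hK, h1, h2, h3⟩ :=
    exists_frame_bound (wedge_ne_zero_of_eigenvectors he he' hne hev hev')
  exact ⟨e, e', K, hK, h1, h2, h3, ⟨μ, hμ, hev⟩, ⟨ν, hν, hev'⟩⟩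

theorem exists_isHyperbolicMatrix :
    ∃ A : Matrix (Fin 2) (Fin 2) ℤ, A.det = 1 ∧ IsHyperbolicMatrix A := by
  refine ⟨!![2, 1; 1, 1], by simp [Matrix.det_fin_two], fun μ hμ h1 => ?_⟩
  rw [spectrum.mem_iff, Matrix.isUnit_iff_isUnit_det, isUnit_iff_ne_zero, not_not,
    Matrix.det_fin_two] at hμ
  simp [Matrix.algebraMap_matrix_apply] at hμ
  have h2 : μ.re * μ.re + μ.im * μ.im = 1 := by
    rw [← Complex.normSq_apply, Complex.normSq_eq_norm_sq, h1, one_pow]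
  have hre := congrArg Complex.re hμ
  have him := congrArg Complex.im hμ
  simp at hre him
  -- Imaginary part of μ² - 3μ + 1 = 0. A real μ of modulus one is ±1, not a root; otherwise μ.re =
  -- 3/2 exceeds the modulus.
  have h3 : μ.im * (2 * μ.re - 3) = 0 := by linarith
  rcases mul_eq_zero.1 h3 with h4 | h4
  · rw [h4] at hre h2
    nlinarith
  · nlinarith [mul_self_nonneg μ.im]

end Existence

/-! ### Topology of the fold. -/

/-- A continuous surjection of the torus whose fibres are the orbits of the antipodal map. -/
structure IsTorusFold {X : Type*} [TopologicalSpace X] (p : Torus → X) : Prop where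
  continuous : Continuous p
  surjective : Function.Surjective p
  eq_iff : ∀ x y, p x = p y ↔ x = y ∨ x = -y

section Fold

variable {X : Type*} [MetricSpace X] {p : Torus → X}

theorem IsTorusFold.apply_neg (hp : IsTorusFold p) (x : Torus) : p (-x) = p x :=
  (hp.eq_iff _ _).2 (Or.inr rfl)

theorem IsTorusFold.isQuotientMap (hp : IsTorusFold p) : IsQuotientMap p :=
  hp.continuous.isClosedMap.isQuotientMap hp.continuous hp.surjective

theorem IsTorusFold.isOpenMap (hp : IsTorusFold p) : IsOpenMap p := by
  intro U hU
  rw [← hp.isQuotientMap.isOpen_preimage]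
  have h : p ⁻¹' (p '' U) = U ∪ Neg.neg ⁻¹' U := by
    ext x
    simp only [mem_preimage, mem_image, mem_union]
    constructor
    · rintro ⟨y, hy, hxy⟩
      rcases (hp.eq_iff _ _).1 hxy with rfl | rfl
      · exact Or.inl hy
      · exact Or.inr hy
    · rintro (hx | hx)
      · exact ⟨x, hx, rfl⟩
      · exact ⟨-x, hx, hp.apply_neg x⟩
  rw [h]
  exact hU.union (hU.preimage continuous_neg)

/-- Points of a fold that are close have lifts that are close. -/
theorem IsTorusFold.exists_norm_lt (hp : IsTorusFold p) {η : ℝ} (hη : 0 < η) :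
    ∃ c : ℝ, 0 < c ∧ ∀ x y, dist (p x) (p y) ≤ c → ‖x - y‖ < η ∨ ‖x + y‖ < η := by
  -- On this compact set of pairs p x ≠ p y, so the distance is bounded below by a positive
  -- constant.
  have hK : IsCompact {z : Torus × Torus | η ≤ ‖z.1 - z.2‖ ∧ η ≤ ‖z.1 + z.2‖} := by
    refine IsClosed.isCompact ?_
    rw [ofPred_and]
    refine (isClosed_le ?_ ?_).inter (isClosed_le ?_ ?_) <;> fun_prop
  have hcont : Continuous fun z : Torus × Torus => dist (p z.1) (p z.2) :=
    (hp.continuous.comp continuous_fst).dist (hp.continuous.comp continuous_snd)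
  obtain ⟨c, hc, h⟩ := hK.exists_forall_le' hcont.continuousOn (a := 0) (by
    rintro ⟨x, y⟩ ⟨h1, h2⟩
    refine dist_pos.2 fun hxy => ?_
    rcases (hp.eq_iff x y).1 hxy with rfl | rfl
    · simp only [sub_self, norm_zero] at h1
      linarith
    · simp only [neg_add_cancel, norm_zero] at h2
      linarith)
  refine ⟨c / 2, half_pos hc, fun x y hxy => ?_⟩
  by_contra hcon
  rw [not_or, not_lt, not_lt] at hcon
  have := h (x, y) hcon
  simp only at this
  linarith

theorem IsTorusFold.exists_dist_le (hp : IsTorusFold p) {ε : ℝ} (hε : 0 < ε) :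
    ∃ η : ℝ, 0 < η ∧ ∀ x y, ‖x - y‖ < η → dist (p x) (p y) ≤ ε := by
  obtain ⟨η, hη, h⟩ := Metric.uniformContinuous_iff.1
    (CompactSpace.uniformContinuous_of_continuous hp.continuous) ε hε
  exact ⟨η, hη, fun x y hxy => (h (by rwa [dist_eq_norm])).le⟩

end Fold

/-! ### Stable continua and segments of stable lines. -/

section Stable

variable {X : Type*} [MetricSpace X] {p : Torus → X} {F : X ≃ₜ X}
  {A B : Matrix (Fin 2) (Fin 2) ℤ} {e e' : Fin 2 → ℝ} {K : ℝ}

theorem iterate_fold (hF : ∀ x, F (p x) = p (torusMap B x)) (n : ℕ) (x : Torus) :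
    F^[n] (p x) = p ((torusMap B)^[n] x) :=
  ((Function.Semiconj.iterate_right (fun x => (hF x).symm) n : Function.Semiconj p _ _) x).symm

theorem self_mem_localStable {c : ℝ} (hc : 0 ≤ c) (x : X) : x ∈ localStable F c x := fun n => by
  simpa using hc

theorem self_mem_stableContinuum {c : ℝ} (hc : 0 ≤ c) (x : X) : x ∈ stableContinuum F c x :=
  mem_connectedComponentIn (self_mem_localStable hc x)

/-- Points of a small stable continuum have a lift that stays close in finite time. -/
theorem IsTorusFold.exists_lift_of_mem_stableContinuum (hp : IsTorusFold p)
    (hF : ∀ x, F (p x) = p (torusMap B x)) {c η : ℝ} (hc0 : 0 ≤ c) (hη : 0 < η)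
    (hc : ∀ x y, dist (p x) (p y) ≤ c → ‖x - y‖ < η ∨ ‖x + y‖ < η) (x : Torus) (m : ℕ) {z : X}
    (hz : z ∈ stableContinuum F c (p x)) :
    ∃ y, p y = z ∧ ∀ n ≤ m, η + η ≤ ‖(torusMap B)^[n] x + (torusMap B)^[n] x‖ →
      ‖(torusMap B)^[n] y - (torusMap B)^[n] x‖ < η := by
  set T := torusMap B with hT
  -- These are the times at which T^n x and -T^n x are well separated. Only finitely many are kept,
  -- so that `G` below is open.
  let N : Set ℕ := {n | n ≤ m ∧ η + η ≤ ‖T^[n] x + T^[n] x‖}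
  have hN : N.Finite := (finite_Iic m).subset fun n hn => hn.1
  have hTc : ∀ n, Continuous T^[n] := continuous_iterate_torusMap B
  let G : Set Torus := ⋂ n ∈ N, {y | ‖T^[n] y - T^[n] x‖ < η}
  let G' : Set Torus := ⋂ n ∈ N, {y | η ≤ ‖T^[n] y + T^[n] x‖}
  have hG : IsOpen G := hN.isOpen_biInter fun n _ =>
    isOpen_lt (((hTc n).sub continuous_const).norm) continuous_const
  have hG' : IsClosed G' := isClosed_biInter fun n _ =>
    isClosed_le continuous_const (((hTc n).add continuous_const).norm)
  have hGG' : G ⊆ G' := by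
    intro y hy
    simp only [G, G', mem_iInter, mem_ofPred_eq] at hy ⊢
    intro n hn
    have h1 := hy n hn
    have h2 : T^[n] x + T^[n] x = (T^[n] y + T^[n] x) - (T^[n] y - T^[n] x) := by abel
    have h3 := norm_sub_le (T^[n] y + T^[n] x) (T^[n] y - T^[n] x)
    rw [← h2] at h3
    linarith [hn.2]
  have hxG : x ∈ G := by
    simp only [G, mem_iInter, mem_ofPred_eq]
    intro n _
    simpa using hη
  -- On the continuum, being η-far from -T^n x forces being η-close to T^n x, so the open set p(G)
  -- and the closed set p(G') have the same trace. That trace is clopen and contains p x, hence is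
  -- the whole continuum.
  have hcov : stableContinuum F c (p x) ⊆ p '' G ∪ (p '' G')ᶜ := by
    intro w hw
    by_cases hw' : w ∈ p '' G'
    · left
      obtain ⟨y, hy, rfl⟩ := hw'
      refine ⟨y, ?_, rfl⟩
      have hst : p y ∈ localStable F c (p x) := connectedComponentIn_subset _ _ hw
      simp only [G, G', mem_iInter, mem_ofPred_eq] at hy ⊢
      intro n hn
      have h1 := hst n
      rw [iterate_fold hF, iterate_fold hF] at h1
      exact (hc _ _ h1).resolve_right (not_lt.2 (hy n hn))
    · exact Or.inr hw'
  have hsub := isPreconnected_iff_subset_of_disjoint.1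
    (isPreconnected_connectedComponentIn : IsPreconnected (stableContinuum F c (p x)))
    (p '' G) (p '' G')ᶜ (hp.isOpenMap G hG)
    (hp.continuous.isClosedMap G' hG').isOpen_compl hcov (by
      rw [eq_empty_iff_forall_notMem]
      rintro w ⟨-, hw, hw'⟩
      exact hw' (image_mono hGG' hw))
  rcases hsub with h | h
  · obtain ⟨y, hy, rfl⟩ := h hz
    refine ⟨y, rfl, fun n hn hn' => ?_⟩
    simp only [G, mem_iInter, mem_ofPred_eq] at hy
    exact hy n ⟨hn, hn'⟩
  · exact absurd ⟨x, hGG' hxG, rfl⟩ (h (self_mem_stableContinuum hc0 (p x)))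

/-- Points of a small stable continuum have a lift whose forward orbit stays close. -/
theorem IsTorusFold.exists_lift_iterate_le (hp : IsTorusFold p)
    (hF : ∀ x, F (p x) = p (torusMap B x)) {c η : ℝ} (hc0 : 0 ≤ c) (hη : 0 < η)
    (hc : ∀ x y, dist (p x) (p y) ≤ c → ‖x - y‖ < η ∨ ‖x + y‖ < η) (x : Torus) {z : X}
    (hz : z ∈ stableContinuum F c (p x)) :
    ∃ y, p y = z ∧ ∀ n, ‖(torusMap B)^[n] (y - x)‖ ≤ 3 * η := by
  have hfin := fun m => hp.exists_lift_of_mem_stableContinuum hF hc0 hη hc x m hz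
  have hex : ∃ y, p y = z ∧ ∀ n, η + η ≤ ‖(torusMap B)^[n] x + (torusMap B)^[n] x‖ →
      ‖(torusMap B)^[n] y - (torusMap B)^[n] x‖ < η := by
    -- The lift found so far depends on the horizon m. The fibre is {y, -y}: if y fails at time n₀,
    -- then -y is the lift for every horizon beyond n₀.
    obtain ⟨y, rfl⟩ := hp.surjective z
    by_cases h : ∀ n, η + η ≤ ‖(torusMap B)^[n] x + (torusMap B)^[n] x‖ →
      ‖(torusMap B)^[n] y - (torusMap B)^[n] x‖ < η
    · exact ⟨y, rfl, h⟩
    · push Not at h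
      obtain ⟨n₀, h0, h1⟩ := h
      refine ⟨-y, hp.apply_neg y, fun n hn => ?_⟩
      obtain ⟨w, hw, hw'⟩ := hfin (max n n₀)
      rcases (hp.eq_iff _ _).1 hw with rfl | rfl
      · exact absurd (hw' n₀ (le_max_right _ _) h0) (not_lt.2 h1)
      · exact hw' n (le_max_left _ _) hn
  obtain ⟨y, rfl, hy⟩ := hex
  refine ⟨y, rfl, fun n => ?_⟩
  rw [iterate_torusMap_sub]
  by_cases hn : η + η ≤ ‖(torusMap B)^[n] x + (torusMap B)^[n] x‖
  · linarith [hy n hn]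
  -- At the remaining times 2 T^n x has norm below 2η, so even closeness to -T^n x gives closeness
  -- to T^n x, within 3η.
  · have hst : p y ∈ localStable F c (p x) := connectedComponentIn_subset _ _ hz
    have h1 := hst n
    rw [iterate_fold hF, iterate_fold hF] at h1
    rcases hc _ _ h1 with h2 | h2
    · linarith
    · have h3 := norm_sub_le ((torusMap B)^[n] y + (torusMap B)^[n] x)
        ((torusMap B)^[n] x + (torusMap B)^[n] x)
      rw [add_sub_add_right_eq_sub] at h3
      linarith

/-- Small stable continua lie in the images of short segments of stable lines. -/
theorem IsTorusFold.exists_stableContinuum_subset (hp : IsTorusFold p)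
    (hF : ∀ x, F (p x) = p (torusMap B x)) (E : EigenFrame B e e' K) {r : ℝ} (hr : 0 < r) :
    ∃ c₀ : ℝ, 0 < c₀ ∧ ∀ c, 0 ≤ c → c ≤ c₀ → ∀ x, ∀ z ∈ stableContinuum F c (p x),
      ∃ a : ℝ, |a| ≤ r ∧ z = p (x + toTorus (a • e)) := by
  obtain ⟨η₀, hη₀, h⟩ := E.exists_of_iterate_le
  have hK := E.pos
  set η := min η₀ (r / K) with hηdef
  have hη : 0 < η := by positivity
  obtain ⟨c₀, hc₀, hc⟩ := hp.exists_norm_lt (show 0 < η / 3 by positivity)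
  refine ⟨c₀, hc₀, fun c hc0 hcc x z hz => ?_⟩
  obtain ⟨y, rfl, hy⟩ := hp.exists_lift_iterate_le hF hc0 (show 0 < η / 3 by positivity)
    (fun x y hxy => hc x y (hxy.trans hcc)) x hz
  obtain ⟨a, ha, hya⟩ := h η (min_le_left _ _) (y - x) (fun n => (hy n).trans_eq (by ring))
  refine ⟨a, ha.trans ?_, by rw [← hya, add_sub_cancel]⟩
  rw [← le_div_iff₀' hK]
  exact min_le_right _ _

/-- Images of short segments of stable lines lie in stable continua. -/
theorem IsTorusFold.exists_mem_stableContinuum (hp : IsTorusFold p)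
    (hF : ∀ x, F (p x) = p (torusMap B x)) (E : EigenFrame B e e' K) {ε : ℝ} (hε : 0 < ε) :
    ∃ r : ℝ, 0 < r ∧ ∀ x, ∀ a : ℝ, |a| ≤ r →
      p (x + toTorus (a • e)) ∈ stableContinuum F ε (p x) := by
  obtain ⟨η, hη, h⟩ := hp.exists_dist_le hε
  obtain ⟨μ, hμ, he⟩ := E.contracted
  have hpos : 0 < ‖e‖ := norm_pos_iff.2 E.left_ne_zero
  refine ⟨η / (2 * ‖e‖), by positivity, fun x a ha => ?_⟩
  set r := η / (2 * ‖e‖) with hr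
  have hre : r * ‖e‖ < η := by
    rw [hr]
    field_simp
    linarith
  have hr0 : 0 ≤ r := by positivity
  let γ : ℝ → X := fun t => p (x + toTorus (t • e))
  have hγ : Continuous γ := hp.continuous.comp
    (continuous_const.add (continuous_toTorus.comp (continuous_id.smul continuous_const)))
  have hpre : IsPreconnected (γ '' Icc (-r) r) := isPreconnected_Icc.image _ hγ.continuousOn
  -- Forward iterates contract the segment, so it stays within the scale of uniform continuity of
  -- `p`.
  have hsub : γ '' Icc (-r) r ⊆ localStable F ε (p x) := by
    rintro _ ⟨t, ht, rfl⟩ n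
    rw [iterate_fold hF, iterate_fold hF]
    apply h
    rw [← iterate_torusMap_sub, add_sub_cancel_left, iterate_torusMap_toTorus_smul he]
    refine lt_of_le_of_lt ((norm_toTorus_le _).trans ?_) hre
    rw [norm_smul, Real.norm_eq_abs, abs_mul, abs_pow]
    gcongr
    calc |μ| ^ n * |t| ≤ 1 * |t| := by
          gcongr
          exact pow_le_one₀ (abs_nonneg _) hμ.le
      _ = |t| := one_mul _
      _ ≤ r := abs_le.2 ht
  have hmem : p x ∈ γ '' Icc (-r) r :=
    ⟨0, by simpa using hr0, by simp [γ, toTorus_zero]⟩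
  exact hpre.subset_connectedComponentIn hmem hsub ⟨a, abs_le.1 ha, rfl⟩

end Stable

/-! ### Intersections of stable and unstable continua in the fold. -/

section Counting

variable {X : Type*} [MetricSpace X] {p : Torus → X} {F : X ≃ₜ X}
  {A B : Matrix (Fin 2) (Fin 2) ℤ} {e e' : Fin 2 → ℝ} {K : ℝ}

/-- The frame coordinates embed a neighbourhood of the origin into the torus. -/
theorem EigenFrame.exists_injective (E : EigenFrame B e e' K) :
    ∃ r : ℝ, 0 < r ∧ ∀ a b a' b' : ℝ, |a| ≤ r → |b| ≤ r → |a'| ≤ r → |b'| ≤ r →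
      toTorus (a • e + b • e') = toTorus (a' • e + b' • e') → a = a' ∧ b = b' := by
  have hpos : 0 < ‖e‖ + ‖e'‖ := add_pos_of_pos_of_nonneg
    (norm_pos_iff.2 E.left_ne_zero) (norm_nonneg _)
  -- This makes each vector have norm at most 1/4, so differences have norm at most 1/2 and the
  -- projection separates them.
  refine ⟨1 / (4 * (‖e‖ + ‖e'‖)), by positivity, fun a b a' b' ha hb ha' hb' h => ?_⟩
  set r := 1 / (4 * (‖e‖ + ‖e'‖)) with hr
  have hrr : r * (‖e‖ + ‖e'‖) = 1 / 4 := by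
    rw [hr]
    field_simp
  have hbound : ∀ s t : ℝ, |s| ≤ r → |t| ≤ r → ‖s • e + t • e'‖ ≤ 1 / 4 := by
    intro s t hs ht
    calc ‖s • e + t • e'‖ ≤ ‖s • e‖ + ‖t • e'‖ := norm_add_le _ _
      _ = |s| * ‖e‖ + |t| * ‖e'‖ := by rw [norm_smul, norm_smul, Real.norm_eq_abs, Real.norm_eq_abs]
      _ ≤ r * ‖e‖ + r * ‖e'‖ := by gcongr
      _ = 1 / 4 := by rw [← mul_add, hrr]
  have heq := eq_of_toTorus_eq h (by
    have := norm_sub_le (a • e + b • e') (a' • e + b' • e')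
    linarith [hbound a b ha hb, hbound a' b' ha' hb'])
  have h0 : (a - a') • e + (b - b') • e' = 0 := by
    rw [sub_smul, sub_smul, ← sub_eq_zero.2 heq]
    abel
  have h1 := E.left_le (a - a') (b - b')
  have h2 := E.right_le (a - a') (b - b')
  rw [h0, norm_zero, mul_zero] at h1 h2
  exact ⟨sub_eq_zero.1 (abs_nonpos_iff.1 h1), sub_eq_zero.1 (abs_nonpos_iff.1 h2)⟩

/-- A common point other than p x solves a e + b e' = -2x on the torus. Injectivity of the frame
coordinates makes a, hence the point, unique. -/
theorem IsTorusFold.exists_encard_le_two (hp : IsTorusFold p)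
    (hF : ∀ x, F (p x) = p (torusMap B x)) (hF' : ∀ x, F.symm (p x) = p (torusMap A x))
    (hAB : A * B = 1) (E : EigenFrame B e e' K) :
    ∃ c : ℝ, 0 < c ∧ ∀ z : X, (stableContinuum F c z ∩ unstableContinuum F c z).encard ≤ 2 := by
  obtain ⟨r, hr, hinj⟩ := E.exists_injective
  obtain ⟨c, hc, h⟩ := hp.exists_stableContinuum_subset hF E hr
  obtain ⟨c', hc', h'⟩ := hp.exists_stableContinuum_subset hF' (E.symm hAB) hr
  have hm : 0 < min c c' := lt_min hc hc'
  refine ⟨min c c', hm, fun z => ?_⟩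
  obtain ⟨x, rfl⟩ := hp.surjective z
  have key : ∀ w ∈ stableContinuum F (min c c') (p x) ∩ unstableContinuum F (min c c') (p x),
      w ≠ p x → ∃ a b : ℝ, |a| ≤ r ∧ |b| ≤ r ∧ w = p (x + toTorus (a • e)) ∧
        toTorus (a • e + b • e') = -(x + x) := by
    rintro w ⟨hw, hw'⟩ hne
    obtain ⟨a, ha, hwa⟩ := h _ hm.le (min_le_left _ _) x w hw
    obtain ⟨b, hb, hwb⟩ := h' _ hm.le (min_le_right _ _) x w hw'
    refine ⟨a, b, ha, hb, hwa, ?_⟩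
    rcases (hp.eq_iff _ _).1 (hwa.symm.trans hwb) with h1 | h1
    · exfalso
      have h2 := hinj a 0 0 b ha (by simpa using hr.le) (by simpa using hr.le) hb
        (by simpa using h1)
      rw [h2.1, zero_smul, toTorus_zero, add_zero] at hwa
      exact hne hwa
    · rw [toTorus_add, eq_sub_of_add_eq' h1]
      abel
  by_cases hs : stableContinuum F (min c c') (p x) ∩ unstableContinuum F (min c c') (p x) ⊆ {p x}
  · exact (encard_le_encard hs).trans (by rw [encard_singleton]; exact one_le_two)
  · obtain ⟨w, hw, hwne⟩ := not_subset.1 hs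
    refine (encard_le_encard (t := {p x, w}) fun w' hw' => ?_).trans
      (encard_pair fun h => hwne h.symm).le
    by_cases hne : w' = p x
    · exact Or.inl hne
    · right
      obtain ⟨a, b, ha, hb, h1, h2⟩ := key w hw hwne
      obtain ⟨a', b', ha', hb', h1', h2'⟩ := key w' hw' hne
      have := (hinj a b a' b' ha hb ha' hb' (h2.trans h2'.symm)).1
      rw [mem_singleton_iff, h1, h1', this]

/-- Arbitrarily small stable and unstable continua of a point meet in a second point. -/
theorem IsTorusFold.exists_ne_mem_inter (hp : IsTorusFold p)
    (hF : ∀ x, F (p x) = p (torusMap B x)) (hF' : ∀ x, F.symm (p x) = p (torusMap A x))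
    (hAB : A * B = 1) (E : EigenFrame B e e' K) {c : ℝ} (hc : 0 < c) :
    ∃ z w : X, w ≠ z ∧ w ∈ stableContinuum F c z ∩ unstableContinuum F c z := by
  obtain ⟨r, hr, hinj⟩ := E.exists_injective
  obtain ⟨r₁, hr₁, h⟩ := hp.exists_mem_stableContinuum hF E hc
  obtain ⟨r₂, hr₂, h'⟩ := hp.exists_mem_stableContinuum hF' (E.symm hAB) hc
  obtain ⟨a, ha0, ha, ha₁, ha₂⟩ : ∃ a : ℝ, 0 < a ∧ |a| ≤ r ∧ |a| ≤ r₁ ∧ |a| ≤ r₂ := by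
    have hm : 0 < min r (min r₁ r₂) := by positivity
    refine ⟨min r (min r₁ r₂), hm, ?_⟩
    rw [abs_of_pos hm]
    exact ⟨min_le_left _ _, (min_le_right _ _).trans (min_le_left _ _),
      (min_le_right _ _).trans (min_le_right _ _)⟩
  have hhalf : |a / 2| ≤ r := by
    rw [abs_of_pos ha0] at ha
    rw [abs_of_pos (half_pos ha0)]
    linarith
  -- A vertex of a parallelogram centred at the fixed point 0 of the fold: x + a e and x + a e' are
  -- opposite vertices, so the fold identifies them, while x and x + a e are adjacent and stay
  -- distinct.
  set x := toTorus ((-(a / 2)) • e + (-(a / 2)) • e') with hx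
  have hneg : -x = toTorus ((a / 2) • e + (a / 2) • e') := by
    rw [hx, ← toTorus_neg]
    congr 1
    module
  have hxe : x + toTorus (a • e) = toTorus ((a / 2) • e + (-(a / 2)) • e') := by
    rw [hx, ← toTorus_add]
    congr 1
    module
  have hxe' : p (x + toTorus (a • e)) = p (x + toTorus (a • e')) := by
    rw [hp.eq_iff]
    right
    rw [hx, ← toTorus_add, ← toTorus_add, ← toTorus_neg]
    congr 1
    module
  refine ⟨p x, p (x + toTorus (a • e)), fun heq => ?_, h x a ha₁, ?_⟩
  · rw [hp.eq_iff] at heq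
    rcases heq with h1 | h1
    · rw [add_eq_left] at h1
      have := (hinj a 0 0 0 ha (by simpa using hr.le) (by simpa using hr.le)
        (by simpa using hr.le) (by simpa [toTorus_zero] using h1)).1
      exact ha0.ne' this
    · rw [hneg, hxe] at h1
      have := (hinj _ _ _ _ hhalf (by rwa [abs_neg]) hhalf hhalf h1).2
      linarith
  · rw [hxe']
    exact h' x a ha₂

/-- For nearby lifts write x - y = a e + b e'; then x - a e = y + b e' lies on both lines. -/
theorem IsTorusFold.hasCwLocalProductStructure (hp : IsTorusFold p)
    (hF : ∀ x, F (p x) = p (torusMap B x)) (hF' : ∀ x, F.symm (p x) = p (torusMap A x))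
    (hAB : A * B = 1) (E : EigenFrame B e e' K) : HasCwLocalProductStructure F := by
  intro ε hε
  obtain ⟨r₁, hr₁, h⟩ := hp.exists_mem_stableContinuum hF E hε
  obtain ⟨r₂, hr₂, h'⟩ := hp.exists_mem_stableContinuum hF' (E.symm hAB) hε
  have hK := E.pos
  set η := min r₁ r₂ / K with hη
  have hη0 : 0 < η := by positivity
  have hKη : K * η = min r₁ r₂ := by
    rw [hη]
    field_simp
  obtain ⟨δ, hδ, hd⟩ := hp.exists_norm_lt hη0
  refine ⟨δ, hδ, fun z w hzw => ?_⟩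
  obtain ⟨x, rfl⟩ := hp.surjective z
  obtain ⟨y, rfl, hxy⟩ : ∃ y, p y = w ∧ ‖x - y‖ < η := by
    obtain ⟨y, rfl⟩ := hp.surjective w
    rcases hd _ _ hzw.le with h1 | h1
    · exact ⟨y, rfl, h1⟩
    · exact ⟨-y, hp.apply_neg y, by rwa [sub_neg_eq_add]⟩
  obtain ⟨v, hv, hvn⟩ := exists_toTorus_eq (x - y)
  obtain ⟨a, b, rfl⟩ := E.span v
  have hle : K * ‖a • e + b • e'‖ ≤ min r₁ r₂ := by
    rw [hvn, ← hKη]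
    gcongr
  have ha := ((E.left_le a b).trans hle).trans (min_le_left _ _)
  have hb := ((E.right_le a b).trans hle).trans (min_le_right _ _)
  have heq : x + toTorus ((-a) • e) = y + toTorus (b • e') := by
    rw [neg_smul, toTorus_neg, ← sub_eq_add_neg, sub_eq_iff_eq_add, add_assoc, ← toTorus_add,
      add_comm (b • e'), hv, add_sub_cancel]
  exact ⟨p (x + toTorus ((-a) • e)), h x (-a) (by rwa [abs_neg]), by rw [heq]; exact h' y b hb⟩

end Counting

/-! ### Products with the maximum metric. -/

section Products

variable {X : Type*} [MetricSpace X] {f : X ≃ₜ X} {N : ℕ} {c : ℝ}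

/-- A bound on the intersections of stable and unstable continua gives cw-expansiveness. -/
theorem isCwNExpansive_of_encard_le {M : ℕ} (hc : 0 < c)
    (h : ∀ x, (stableContinuum f c x ∩ unstableContinuum f c x).encard ≤ M) :
    IsCwNExpansive M f := by
  -- Halving c allows recentring: a connected set in the c/2-sets of x lies in the c-continua of
  -- each of its own points y, so it is finite, hence trivial.
  refine ⟨⟨c / 2, half_pos hc, fun x s hs hpre y hy z hz => ?_⟩, c, hc, h⟩
  have hst : s ⊆ localStable f c y := fun w hw n => by
    have h1 := (hs hw).2 n
    have h2 := (hs hy).2 n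
    linarith [dist_triangle_right (f^[n] w) (f^[n] y) (f^[n] x)]
  have hun : s ⊆ localUnstable f c y := fun w hw n => by
    have h1 := (hs hw).1 n
    have h2 := (hs hy).1 n
    linarith [dist_triangle_right (f.symm^[n] w) (f.symm^[n] y) (f.symm^[n] x)]
  have hsub : s ⊆ stableContinuum f c y ∩ unstableContinuum f c y :=
    subset_inter (hpre.subset_connectedComponentIn hy hst)
      (hpre.subset_connectedComponentIn hy hun)
  have hfin : s.Finite := finite_of_encard_le_coe ((encard_le_encard hsub).trans (h y))
  exact hfin.countable.isTotallyDisconnected s Subset.rfl hpre hy hz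

theorem iterate_prodCopies (n : ℕ) (x : Fin N → X) :
    (prodCopies N f)^[n] x = fun i => f^[n] (x i) := by
  induction n with
  | zero => rfl
  | succ n ih =>
    rw [Function.iterate_succ_apply', ih]
    funext i
    rw [Function.iterate_succ_apply']
    rfl

theorem localStable_prodCopies (hc : 0 ≤ c) (x : Fin N → X) :
    localStable (prodCopies N f) c x = univ.pi fun i => localStable f c (x i) := by
  ext y
  simp only [localStable, mem_ofPred_eq, mem_univ_pi, iterate_prodCopies, dist_pi_le_iff hc]
  exact forall_comm

theorem stableContinuum_prodCopies (hc : 0 ≤ c) (x : Fin N → X) :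
    stableContinuum (prodCopies N f) c x = univ.pi fun i => stableContinuum f c (x i) := by
  apply Subset.antisymm
  · intro y hy i _
    have hpre : IsPreconnected (Function.eval i '' stableContinuum (prodCopies N f) c x) :=
      isPreconnected_connectedComponentIn.image _ (continuous_apply i).continuousOn
    refine hpre.subset_connectedComponentIn ⟨x, self_mem_stableContinuum hc x, rfl⟩ ?_ ⟨y, hy, rfl⟩
    rintro _ ⟨w, hw, rfl⟩
    have hw' := connectedComponentIn_subset _ _ hw
    rw [localStable_prodCopies hc] at hw'
    exact hw' i (mem_univ i)
  · refine IsPreconnected.subset_connectedComponentIn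
      (isPreconnected_univ_pi fun i => isPreconnected_connectedComponentIn)
      (fun i _ => self_mem_stableContinuum hc (x i)) ?_
    rw [localStable_prodCopies hc]
    exact pi_mono fun i _ => connectedComponentIn_subset _ _

/-- The inverse of a product map is the product of the inverses, and unstable continua are by
definition stable continua of the inverse. -/
theorem unstableContinuum_prodCopies (hc : 0 ≤ c) (x : Fin N → X) :
    unstableContinuum (prodCopies N f) c x = univ.pi fun i => unstableContinuum f c (x i) :=
  stableContinuum_prodCopies (f := f.symm) hc x

theorem encard_inter_prodCopies (hc : 0 ≤ c) (x : Fin N → X) :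
    (stableContinuum (prodCopies N f) c x ∩ unstableContinuum (prodCopies N f) c x).encard =
      ∏ i, (stableContinuum f c (x i) ∩ unstableContinuum f c (x i)).encard := by
  rw [stableContinuum_prodCopies hc, unstableContinuum_prodCopies hc, ← pi_inter_distrib,
    encard_pi_eq_prod_encard]

theorem HasCwLocalProductStructure.prodCopies (h : HasCwLocalProductStructure f) (N : ℕ) :
    HasCwLocalProductStructure (prodCopies N f) := by
  intro ε hε
  obtain ⟨δ, hδ, hd⟩ := h ε hε
  refine ⟨δ, hδ, fun x y hxy => ?_⟩
  rw [stableContinuum_prodCopies hε.le, unstableContinuum_prodCopies hε.le, ← pi_inter_distrib,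
    univ_pi_nonempty_iff]
  exact fun i => hd _ _ ((dist_le_pi_dist x y i).trans_lt hxy)

theorem isCwNExpansive_prodCopies {M : ℕ} (hc : 0 < c)
    (h : ∀ x, (stableContinuum f c x ∩ unstableContinuum f c x).encard ≤ M) (N : ℕ) :
    IsCwNExpansive (M ^ N) (prodCopies N f) := by
  refine isCwNExpansive_of_encard_le hc fun x => ?_
  rw [encard_inter_prodCopies hc.le]
  refine (Finset.prod_le_prod' fun i _ => h (x i)).trans ?_
  simp

theorem not_isCwNExpansive_prodCopies
    (h : ∀ c : ℝ, 0 < c → ∃ x, 2 ≤ (stableContinuum f c x ∩ unstableContinuum f c x).encard)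
    (N : ℕ) : ¬ IsCwNExpansive (2 ^ N - 1) (prodCopies N f) := by
  rintro ⟨-, c, hc, hle⟩
  obtain ⟨x, hx⟩ := h c hc
  -- The diagonal point has at least two intersection points in each coordinate.
  have h1 := hle fun _ => x
  rw [encard_inter_prodCopies hc.le] at h1
  have h2 : (2 : ℕ∞) ^ N ≤ ((2 ^ N - 1 : ℕ) : ℕ∞) := by
    refine le_trans ?_ h1
    calc (2 : ℕ∞) ^ N = ∏ _i : Fin N, (2 : ℕ∞) := by simp
      _ ≤ _ := Finset.prod_le_prod' fun i _ => hx
  have h3 : 2 ^ N ≤ 2 ^ N - 1 := by exact_mod_cast h2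
  -- Natural subtraction truncates; positivity of 2^N turns `h3` into a contradiction, including for
  -- N = 0.
  have h4 : 0 < 2 ^ N := by positivity
  omega

theorem IsPeanoContinuum.prodCopies (h : IsPeanoContinuum X) (N : ℕ) :
    IsPeanoContinuum (Fin N → X) := by
  obtain ⟨_, _, _⟩ := h
  exact ⟨inferInstance, inferInstance, inferInstance⟩

end Products

/-! ### Products of maps covered by hyperbolic toral automorphisms. -/

section FoldDynamics

variable {X : Type*} [MetricSpace X] {p : Torus → X} {F : X ≃ₜ X}
  {A B : Matrix (Fin 2) (Fin 2) ℤ} {e e' : Fin 2 → ℝ} {K : ℝ}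

/-- Local connectedness passes from ℝ to the circle, to the torus, and to the fold, by quotients and
finite products. -/
theorem IsTorusFold.isPeanoContinuum (hp : IsTorusFold p) : IsPeanoContinuum X := by
  have h1 : LocallyConnectedSpace UnitAddCircle :=
    (QuotientAddGroup.isQuotientMap_mk (N := AddSubgroup.zmultiples (1 : ℝ))).isCoinducing
      |>.locallyConnectedSpace
  exact ⟨hp.surjective.compactSpace hp.continuous, hp.surjective.connectedSpace hp.continuous,
    hp.isQuotientMap.isCoinducing.locallyConnectedSpace⟩

theorem IsTorusFold.prodCopies (hp : IsTorusFold p)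
    (hF : ∀ x, F (p x) = p (torusMap B x)) (hF' : ∀ x, F.symm (p x) = p (torusMap A x))
    (hAB : A * B = 1) (E : EigenFrame B e e' K) (N : ℕ) :
    IsCwNHyperbolic (2 ^ N) (prodCopies N F) ∧
      ¬ IsCwNExpansive (2 ^ N - 1) (CwHyp.prodCopies N F) := by
  obtain ⟨c, hc, h⟩ := hp.exists_encard_le_two hF hF' hAB E
  have hexp := isCwNExpansive_prodCopies (M := 2) hc (fun x => h x) N
  refine ⟨⟨⟨hp.isPeanoContinuum.prodCopies N, hexp.1,
    (hp.hasCwLocalProductStructure hF hF' hAB E).prodCopies N⟩, hexp⟩,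
    not_isCwNExpansive_prodCopies (fun c hc => ?_) N⟩
  obtain ⟨z, w, hne, hw⟩ := hp.exists_ne_mem_inter hF hF' hAB E hc
  refine ⟨z, ?_⟩
  rw [← encard_pair hne]
  refine encard_le_encard (insert_subset hw (singleton_subset_iff.2 ?_))
  exact ⟨self_mem_stableContinuum hc.le z, self_mem_stableContinuum (F := F.symm) hc.le z⟩

theorem IsLinearCwAnosov.prodCopies {g : Sphere2 ≃ₜ Sphere2} (hg : IsLinearCwAnosov g) (N : ℕ) :
    IsCwNHyperbolic (2 ^ N) (prodCopies N g) ∧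
      ¬ IsCwNExpansive (2 ^ N - 1) (CwHyp.prodCopies N g) := by
  obtain ⟨A, hA, h, hyp, hconj⟩ := hg
  obtain ⟨e, e', K, E⟩ := exists_eigenFrame hA hyp
  let p : Torus → Sphere2 := fun x => h (Quotient.mk antipodalSetoid x)
  have hp : IsTorusFold p :=
    { continuous := h.continuous.comp continuous_quotient_mk'
      surjective := h.surjective.comp Quotient.mk_surjective
      eq_iff := fun x y => h.injective.eq_iff.trans Quotient.eq }
  have hF : ∀ x, g (p x) = p (torusMap A x) := fun x => hconj _
  have hF' : ∀ x, g.symm (p x) = p (torusMap A.adjugate x) := fun x => by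
    rw [Homeomorph.symm_apply_eq, hF, torusMap_mul, Matrix.mul_adjugate, hA, one_smul,
      torusMap_one]
  exact hp.prodCopies hF hF' (by rw [Matrix.adjugate_mul, hA, one_smul]) E N

end FoldDynamics

/-! ### The folded torus is a sphere. -/

section Pillow

/-- The map of the torus onto a pillow-shaped surface in Euclidean three-space. -/
noncomputable def pillowMap (x : Torus) : EuclideanSpace ℝ (Fin 3) :=
  !₂[(AddCircle.toCircle (x 0) : ℂ).re, (AddCircle.toCircle (x 1) : ℂ).re,
    (AddCircle.toCircle (x 0) : ℂ).im * (AddCircle.toCircle (x 1) : ℂ).im]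

theorem continuous_pillowMap : Continuous pillowMap := by
  have h : ∀ i : Fin 2, Continuous fun x : Torus => (AddCircle.toCircle (x i) : ℂ) := fun i =>
    continuous_subtype_val.comp (AddCircle.continuous_toCircle.comp (continuous_apply i))
  refine (PiLp.continuous_toLp 2 _).comp (continuous_pi fun i => ?_)
  fin_cases i
  · exact Complex.continuous_re.comp (h 0)
  · exact Complex.continuous_re.comp (h 1)
  · exact (Complex.continuous_im.comp (h 0)).mul (Complex.continuous_im.comp (h 1))

theorem re_sq_add_im_sq (z : Circle) : (z : ℂ).re ^ 2 + (z : ℂ).im ^ 2 = 1 := by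
  have := Circle.normSq_coe z
  rw [Complex.normSq_apply] at this
  linarith

theorem pillowMap_ne_zero (x : Torus) : pillowMap x ≠ 0 := by
  intro h
  have h0 : (AddCircle.toCircle (x 0) : ℂ).re = 0 := congrArg (fun v => v 0) h
  have h1 : (AddCircle.toCircle (x 1) : ℂ).re = 0 := congrArg (fun v => v 1) h
  have h2 : (AddCircle.toCircle (x 0) : ℂ).im * (AddCircle.toCircle (x 1) : ℂ).im = 0 :=
    congrArg (fun v => v 2) h
  have h3 := re_sq_add_im_sq (AddCircle.toCircle (x 0))
  have h4 := re_sq_add_im_sq (AddCircle.toCircle (x 1))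
  rcases mul_eq_zero.1 h2 with h5 | h5
  · rw [h0, h5] at h3
    norm_num at h3
  · rw [h1, h5] at h4
    norm_num at h4

theorem pillowMap_neg (x : Torus) : pillowMap (-x) = pillowMap x := by
  simp [pillowMap, AddCircle.toCircle_neg]

/-- The pillow surface is star-shaped. -/
theorem le_one_of_pillow {a b s t a' b' s' t' k : ℝ} (h1 : a ^ 2 + s ^ 2 = 1)
    (h2 : b ^ 2 + t ^ 2 = 1) (h1' : a' ^ 2 + s' ^ 2 = 1) (h2' : b' ^ 2 + t' ^ 2 = 1)
    (hk : 0 < k) (ha : a = k * a') (hb : b = k * b') (hst : s * t = k * (s' * t')) : k ≤ 1 := by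
  -- If k > 1, dilation raises both squared cosines and so lowers both squared sines, yet it must
  -- raise their product. So that product is zero, and then a cosine would exceed one in modulus.
  by_contra! hk1
  have hkk : 1 < k ^ 2 := by nlinarith
  have hs : s ^ 2 ≤ s' ^ 2 := by
    rw [ha, mul_pow] at h1
    nlinarith [sq_nonneg a']
  have ht : t ^ 2 ≤ t' ^ 2 := by
    rw [hb, mul_pow] at h2
    nlinarith [sq_nonneg b']
  have h3 : s ^ 2 * t ^ 2 = k ^ 2 * (s' ^ 2 * t' ^ 2) := by
    rw [← mul_pow, hst]
    ring
  have h4 : s ^ 2 * t ^ 2 ≤ s' ^ 2 * t' ^ 2 := by gcongr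
  have h5 : s' ^ 2 * t' ^ 2 = 0 := by
    have : 0 ≤ s' ^ 2 * t' ^ 2 := by positivity
    nlinarith
  rcases mul_eq_zero.1 h5 with h6 | h6
  · have : a ^ 2 = k ^ 2 * a' ^ 2 := by rw [ha, mul_pow]
    nlinarith [sq_nonneg s]
  · have : b ^ 2 = k ^ 2 * b' ^ 2 := by rw [hb, mul_pow]
    nlinarith [sq_nonneg t]

theorem le_one_of_pillowMap_eq_smul {x y : Torus} {k : ℝ} (hk : 0 < k)
    (h : pillowMap x = k • pillowMap y) : k ≤ 1 :=
  le_one_of_pillow (re_sq_add_im_sq (AddCircle.toCircle (x 0)))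
    (re_sq_add_im_sq (AddCircle.toCircle (x 1))) (re_sq_add_im_sq (AddCircle.toCircle (y 0)))
    (re_sq_add_im_sq (AddCircle.toCircle (y 1))) hk (congrArg (fun v => v 0) h)
    (congrArg (fun v => v 1) h) (congrArg (fun v => v 2) h)

/-- The cosines fix each angle up to sign; the product of the sines forces the two signs to agree,
unless a sine vanishes and its sign is immaterial. -/
theorem pillowMap_eq_iff (x y : Torus) : pillowMap x = pillowMap y ↔ x = y ∨ x = -y := by
  refine ⟨fun h => ?_, ?_⟩
  · have h0 : (AddCircle.toCircle (x 0) : ℂ).re = (AddCircle.toCircle (y 0) : ℂ).re :=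
      congrArg (fun v => v 0) h
    have h1 : (AddCircle.toCircle (x 1) : ℂ).re = (AddCircle.toCircle (y 1) : ℂ).re :=
      congrArg (fun v => v 1) h
    have h2 : (AddCircle.toCircle (x 0) : ℂ).im * (AddCircle.toCircle (x 1) : ℂ).im =
      (AddCircle.toCircle (y 0) : ℂ).im * (AddCircle.toCircle (y 1) : ℂ).im :=
      congrArg (fun v => v 2) h
    have hpos : ∀ i, (AddCircle.toCircle (x i) : ℂ).re = (AddCircle.toCircle (y i) : ℂ).re →
        (AddCircle.toCircle (x i) : ℂ).im = (AddCircle.toCircle (y i) : ℂ).im → x i = y i :=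
      fun i hre him => AddCircle.injective_toCircle one_ne_zero
        (Circle.ext (Complex.ext hre him))
    have hneg : ∀ i, (AddCircle.toCircle (x i) : ℂ).re = (AddCircle.toCircle (y i) : ℂ).re →
        (AddCircle.toCircle (x i) : ℂ).im = -(AddCircle.toCircle (y i) : ℂ).im → x i = -y i :=
      fun i hre him => AddCircle.injective_toCircle one_ne_zero
        (Circle.ext (Complex.ext (by simpa [AddCircle.toCircle_neg] using hre)
          (by simpa [AddCircle.toCircle_neg] using him)))
    have him : ∀ i, (AddCircle.toCircle (x i) : ℂ).re = (AddCircle.toCircle (y i) : ℂ).re →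
        (AddCircle.toCircle (x i) : ℂ).im = (AddCircle.toCircle (y i) : ℂ).im ∨
        (AddCircle.toCircle (x i) : ℂ).im = -(AddCircle.toCircle (y i) : ℂ).im := by
      intro i hi
      rw [← sq_eq_sq_iff_eq_or_eq_neg]
      have h3 := re_sq_add_im_sq (AddCircle.toCircle (x i))
      have h4 := re_sq_add_im_sq (AddCircle.toCircle (y i))
      rw [hi] at h3
      linarith
    have key : ((AddCircle.toCircle (x 0) : ℂ).im = (AddCircle.toCircle (y 0) : ℂ).im ∧
        (AddCircle.toCircle (x 1) : ℂ).im = (AddCircle.toCircle (y 1) : ℂ).im) ∨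
        ((AddCircle.toCircle (x 0) : ℂ).im = -(AddCircle.toCircle (y 0) : ℂ).im ∧
        (AddCircle.toCircle (x 1) : ℂ).im = -(AddCircle.toCircle (y 1) : ℂ).im) := by
      rcases him 0 h0 with h3 | h3 <;> rcases him 1 h1 with h4 | h4
      · exact Or.inl ⟨h3, h4⟩
      · rw [h3, h4] at h2
        have h5 : (AddCircle.toCircle (y 0) : ℂ).im * (AddCircle.toCircle (y 1) : ℂ).im = 0 := by
          linarith
        rcases mul_eq_zero.1 h5 with h6 | h6
        · exact Or.inr ⟨by rw [h3, h6, neg_zero], h4⟩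
        · exact Or.inl ⟨h3, by rw [h4, h6, neg_zero]⟩
      · rw [h3, h4] at h2
        have h5 : (AddCircle.toCircle (y 0) : ℂ).im * (AddCircle.toCircle (y 1) : ℂ).im = 0 := by
          linarith
        rcases mul_eq_zero.1 h5 with h6 | h6
        · exact Or.inl ⟨by rw [h3, h6, neg_zero], h4⟩
        · exact Or.inr ⟨h3, by rw [h4, h6, neg_zero]⟩
      · exact Or.inr ⟨h3, h4⟩
    rcases key with ⟨h3, h4⟩ | ⟨h3, h4⟩
    · left
      funext i
      fin_cases i
      exacts [hpos 0 h0 h3, hpos 1 h1 h4]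
    · right
      funext i
      fin_cases i
      exacts [hneg 0 h0 h3, hneg 1 h1 h4]
  · rintro (rfl | rfl)
    · rfl
    · exact pillowMap_neg y

/-- Every ray from the origin meets the pillow surface. -/
theorem exists_pillow_scale {α β γ : ℝ} (h : α ^ 2 + β ^ 2 + γ ^ 2 = 1) :
    ∃ u : ℝ, 0 < u ∧ u * α ^ 2 ≤ 1 ∧ u * β ^ 2 ≤ 1 ∧
      (1 - u * α ^ 2) * (1 - u * β ^ 2) = u * γ ^ 2 := by
  set m := max (α ^ 2) (β ^ 2) with hm
  have hα : α ^ 2 ≤ m := le_max_left _ _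
  have hβ : β ^ 2 ≤ m := le_max_right _ _
  rcases (le_trans (sq_nonneg α) hα).eq_or_lt with h0 | h0
  · have h1 : α ^ 2 = 0 := le_antisymm (h0 ▸ hα) (sq_nonneg _)
    have h2 : β ^ 2 = 0 := le_antisymm (h0 ▸ hβ) (sq_nonneg _)
    exact ⟨1, one_pos, by linarith, by linarith, by nlinarith⟩
  -- Here u is the squared scale. The difference is 1 at u = 0 and nonpositive at u = 1/m, where one
  -- factor vanishes; on this interval both factors are nonnegative.
  · have hcont : ContinuousOn
        (fun u : ℝ => (1 - u * α ^ 2) * (1 - u * β ^ 2) - u * γ ^ 2) (Icc 0 m⁻¹) := by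
      fun_prop
    have hend : (1 - m⁻¹ * α ^ 2) * (1 - m⁻¹ * β ^ 2) = 0 := by
      rcases max_choice (α ^ 2) (β ^ 2) with h1 | h1 <;> rw [← hm] at h1 <;>
        rw [← h1, inv_mul_cancel₀ h0.ne'] <;> simp
    obtain ⟨u, ⟨hu0, hu1⟩, hu⟩ := intermediate_value_Icc' (inv_pos.2 h0).le hcont
      (show (0 : ℝ) ∈ Icc _ _ from ⟨by
        simp only [hend, zero_sub, Left.neg_nonpos_iff]
        positivity, by simp⟩)
    simp only at hu
    have hum : u * m ≤ 1 := by
      rwa [inv_eq_one_div, le_div_iff₀ h0] at hu1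
    refine ⟨u, lt_of_le_of_ne hu0 ?_, (mul_le_mul_of_nonneg_left hα hu0).trans hum,
      (mul_le_mul_of_nonneg_left hβ hu0).trans hum, by linarith⟩
    rintro rfl
    norm_num at hu

theorem exists_toCircle_eq {a s : ℝ} (h : a ^ 2 + s ^ 2 = 1) :
    ∃ θ : UnitAddCircle, (AddCircle.toCircle θ : ℂ).re = a ∧ (AddCircle.toCircle θ : ℂ).im = s := by
  have hz : (⟨a, s⟩ : ℂ) ∈ Submonoid.unitSphere ℂ := by
    rw [← SetLike.mem_coe, Submonoid.coe_unitSphere, mem_sphere_zero_iff_norm,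
      ← sq_eq_sq₀ (norm_nonneg _) zero_le_one,
      ← Complex.normSq_eq_norm_sq, Complex.normSq_mk]
    linarith
  obtain ⟨θ, hθ⟩ := (AddCircle.homeomorphCircle (T := 1) one_ne_zero).surjective ⟨_, hz⟩
  rw [AddCircle.homeomorphCircle_apply] at hθ
  exact ⟨θ, by rw [hθ], by rw [hθ]⟩

theorem exists_pillowMap_eq_smul {v : EuclideanSpace ℝ (Fin 3)} (hv : ‖v‖ = 1) :
    ∃ (k : ℝ) (x : Torus), 0 < k ∧ pillowMap x = k • v := by
  have h1 : v 0 ^ 2 + v 1 ^ 2 + v 2 ^ 2 = 1 := by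
    have := EuclideanSpace.norm_sq_eq v
    rw [hv, Fin.sum_univ_three] at this
    simpa using this.symm
  obtain ⟨u, hu, ha, hb, huv⟩ := exists_pillow_scale h1
  set k := Real.sqrt u
  have hk : 0 < k := Real.sqrt_pos.2 hu
  have hkk : k ^ 2 = u := Real.sq_sqrt hu.le
  set s := Real.sqrt (1 - u * v 0 ^ 2)
  set t := Real.sqrt (1 - u * v 1 ^ 2)
  have hs : s ^ 2 = 1 - u * v 0 ^ 2 := Real.sq_sqrt (by linarith)
  have ht : t ^ 2 = 1 - u * v 1 ^ 2 := Real.sq_sqrt (by linarith)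
  -- The square roots give the sines up to sign; one sign is chosen to match the third coordinate.
  obtain ⟨t', ht', hst⟩ : ∃ t', t' ^ 2 = t ^ 2 ∧ s * t' = k * v 2 := by
    have h2 : (s * t) ^ 2 = (k * v 2) ^ 2 := by
      rw [mul_pow, mul_pow, hs, ht, hkk, huv]
    rcases sq_eq_sq_iff_eq_or_eq_neg.1 h2 with h3 | h3
    · exact ⟨t, rfl, h3⟩
    · exact ⟨-t, neg_sq t, by rw [mul_neg, h3, neg_neg]⟩
  obtain ⟨θ, hθ, hθ'⟩ := exists_toCircle_eq (a := k * v 0) (s := s) (by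
    rw [mul_pow, hkk, hs]
    ring)
  obtain ⟨φ, hφ, hφ'⟩ := exists_toCircle_eq (a := k * v 1) (s := t') (by
    rw [mul_pow, hkk, ht', ht]
    ring)
  refine ⟨k, ![θ, φ], hk, ?_⟩
  ext i
  fin_cases i
  · exact hθ
  · exact hφ
  · change (AddCircle.toCircle θ : ℂ).im * (AddCircle.toCircle φ : ℂ).im = k * v 2
    rw [hθ', hφ', hst]

/-- The radial projection of the pillow surface to the sphere. -/
noncomputable def torusToSphere (x : Torus) : Sphere2 :=
  ⟨‖pillowMap x‖⁻¹ • pillowMap x, by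
    rw [mem_sphere_zero_iff_norm, norm_smul, norm_inv, norm_norm,
      inv_mul_cancel₀ (norm_ne_zero_iff.2 (pillowMap_ne_zero x))]⟩

theorem isTorusFold_torusToSphere : IsTorusFold torusToSphere where
  continuous := Continuous.subtype_mk ((continuous_pillowMap.norm.inv₀
    fun x => norm_ne_zero_iff.2 (pillowMap_ne_zero x)).smul continuous_pillowMap) _
  surjective := by
    rintro ⟨v, hv⟩
    rw [mem_sphere_zero_iff_norm] at hv
    obtain ⟨k, x, hk, hx⟩ := exists_pillowMap_eq_smul hv
    refine ⟨x, Subtype.ext ?_⟩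
    change ‖pillowMap x‖⁻¹ • pillowMap x = v
    rw [hx, norm_smul, hv, mul_one, Real.norm_of_nonneg hk.le, smul_smul,
      inv_mul_cancel₀ hk.ne', one_smul]
  eq_iff x y := by
    rw [← pillowMap_eq_iff]
    refine ⟨fun h => ?_, fun h => by simp only [torusToSphere, h]⟩
    have h1 : ‖pillowMap x‖⁻¹ • pillowMap x = ‖pillowMap y‖⁻¹ • pillowMap y :=
      congrArg Subtype.val h
    have hx : 0 < ‖pillowMap x‖ := norm_pos_iff.2 (pillowMap_ne_zero x)
    have hy : 0 < ‖pillowMap y‖ := norm_pos_iff.2 (pillowMap_ne_zero y)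
    have h2 : pillowMap x = (‖pillowMap x‖ * ‖pillowMap y‖⁻¹) • pillowMap y := by
      rw [mul_smul, ← h1, smul_smul, mul_inv_cancel₀ hx.ne', one_smul]
    have h3 : pillowMap y = (‖pillowMap y‖ * ‖pillowMap x‖⁻¹) • pillowMap x := by
      rw [mul_smul, h1, smul_smul, mul_inv_cancel₀ hy.ne', one_smul]
    -- Star-shapedness bounds the ratio of the norms and its inverse by one, so points on a common
    -- ray coincide.
    have h4 := le_one_of_pillowMap_eq_smul (by positivity) h2
    have h5 := le_one_of_pillowMap_eq_smul (by positivity) h3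
    rw [← div_eq_mul_inv, div_le_one (by assumption)] at h4 h5
    rw [le_antisymm h4 h5, mul_inv_cancel₀ hy.ne', one_smul] at h2
    exact h2

/-- The quotient of the torus by the antipodal map is a sphere. -/
noncomputable def torusQuotientHomeoSphere : TorusQuotient ≃ₜ Sphere2 :=
  Continuous.homeoOfEquivCompactToT2
    (f := Equiv.ofBijective
      (Quotient.lift (s := antipodalSetoid) torusToSphere
        fun x y h => (isTorusFold_torusToSphere.eq_iff x y).2 h)
      ⟨by
        rintro ⟨x⟩ ⟨y⟩ h
        exact Quotient.sound ((isTorusFold_torusToSphere.eq_iff x y).1 h),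
      fun z => (isTorusFold_torusToSphere.surjective z).imp'
        (Quotient.mk antipodalSetoid) fun _ h => h⟩)
    (isTorusFold_torusToSphere.continuous.quotient_lift _)

theorem exists_isLinearCwAnosov : ∃ g : Sphere2 ≃ₜ Sphere2, IsLinearCwAnosov g := by
  obtain ⟨A, hA, hyp⟩ := exists_isHyperbolicMatrix
  refine ⟨(torusQuotientHomeoSphere.symm.trans (quotientHomeo A hA)).trans
    torusQuotientHomeoSphere, A, hA, torusQuotientHomeoSphere, hyp, fun q => ?_⟩
  simp

end Pillow

end CwHyp

theorem mainTheorem8 :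
    (∀ N : ℕ, ∃ (X : Type) (_ : MetricSpace X) (f : X ≃ₜ X),
      CwHyp.IsCwNHyperbolic (2 ^ N) f ∧ ¬ CwHyp.IsCwNExpansive (2 ^ N - 1) f) ∧
    (∃ g : CwHyp.Sphere2 ≃ₜ CwHyp.Sphere2, CwHyp.IsLinearCwAnosov g) ∧
    (∀ g : CwHyp.Sphere2 ≃ₜ CwHyp.Sphere2, CwHyp.IsLinearCwAnosov g → ∀ N : ℕ,
      CwHyp.IsCwNHyperbolic (2 ^ N) (CwHyp.prodCopies N g) ∧
      ¬ CwHyp.IsCwNExpansive (2 ^ N - 1) (CwHyp.prodCopies N g)) := by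
  refine ⟨fun N => ?_, CwHyp.exists_isLinearCwAnosov, fun g hg N => hg.prodCopies N⟩
  obtain ⟨g, hg⟩ := CwHyp.exists_isLinearCwAnosov
  exact ⟨Fin N → CwHyp.Sphere2, inferInstance, CwHyp.prodCopies N g, hg.prodCopies N⟩
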